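/- All graphs are finite, simple, undirected and unlabelled. For $k\ge 2$, the $k$-dimensional Weisfeiler–Leman algorithm ($k$-WL) colors the $k$-tuples of vertices of a graph $G=(V,E)$. Initially, $c^0_{\vec v}$ is the isomorphism type of $\vec v=(v_1,\dots,v_k)$, i.e. the data, for all $i,j\in[k]$, of whether $v_i=v_j$ and whether $v_iv_j\in E$. In round $t\ge 1$, $$c^t_{\vec v}=\mathrm{HASH}\bigl(c^{t-1}_{\vec v},c^t_{\vec v,(1)},\dots,c^t_{\vec v,(k)}\bigr),\qquad c^t_{\vec v,(i)}=\{\!\!\{c^{t-1}_{(v_1,\dots,v_{i-1},w,v_{i+1},\dots,v_k)} : w\in V\}\!\!\},$$ with $\mathrm{HASH}$ injective and the same for all graphs. $k$-WL distinguishes $G$ from $H$ if for some $t\ge 0$ the multisets of the colors $c^t$ of all $k$-tuples of $G$ and of $H$ differ. $k$-WL can count a graph $S$ if it distinguishes any two graphs that have different numbers of (not necessarily induced) subgraphs isomorphic to $S$. For $k\ge 2$ and $\ell\in\{0,1\}$ let $G_k^{(\ell)}$ be the following graph of Cai–Fürer–Immerman type. Its vertices are the $u_{a,\vec v}$ with $a\in[k+1]$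 and $\vec v\in\{0,1\}^k$, where $\vec v$ has an even number of ones if $a\le k-\ell+1$ and an odd number of ones if $a>k-\ell+1$. Two vertices $u_{a,\vec v}$ and $u_{a',\vec v'}$ are adjacent iff there is $j\in[k]$ with $a'\equiv a+j \pmod{k+1}$ and $v_j=v'_{k-j+1}$. **Theorem 4.1.** Let $m\ge 2$, $G=G_m^{(0)}$ and $H=G_m^{(1)}$. Then $G$ contains an $(m+1)$-clique, $H$ contains no $(m+1)$-clique, and $m$-WL does not distinguish $G$ from $H$. Moreover, $m$-WL can count every connected graph on at most $m$ vertices, and it cannot count the $(m+1)$-clique, so that the bound $m$ on the number of vertices is tight. -/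

import Mathlib

open Finset

/-- Colours of `k`-tuples at round `t` of the `k`-dimensional Weisfeiler-Leman algorithm. At round
`0` a colour is an isomorphism type: the equality pattern and the adjacency matrix of a `k`-tuple. At
round `t + 1` it consists of the previous colour and one multiset of colours per coordinate.
Colours are these data themselves, so that the hash function is the identity, in particular
injective. -/
def WLColor (k : ℕ) : ℕ → Type
  | 0 => Fin k → Fin k → Prop × Prop
  | t + 1 => WLColor k t × (Fin k → Multiset (WLColor k t))

/-- The colour of a `k`-tuple `v` of vertices of `G` at each round. The `i`-th neighbours of `v` are
the tuples `Function.update v i w`, where `w` runs through all vertices. -/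
def wlColor {V : Type*} [Fintype V] (G : SimpleGraph V) (k : ℕ) :
    (t : ℕ) → (Fin k → V) → WLColor k t
  | 0, v => fun i j => (v i = v j, G.Adj (v i) (v j))
  | t + 1, v =>
      (wlColor G k t v,
        fun i => (univ : Finset V).val.map fun w => wlColor G k t (Function.update v i w))

/-- The colour histogram of `G` after `t` rounds: the multiset of the colours of all `k`-tuples. -/
def wlHistogram {V : Type*} [Fintype V] (G : SimpleGraph V) (k t : ℕ) : Multiset (WLColor k t) :=
  (univ : Finset (Fin k → V)).val.map (wlColor G k t)

/-- `k`-WL distinguishes `G` from `H`: the colour histograms differ at some round. A colour determines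
the colours of all earlier rounds, so histograms that differ at one round differ at
all later rounds, in particular once the colouring has become stable. -/
def WLDistinguishes {V W : Type*} [Fintype V] [Fintype W] (k : ℕ)
    (G : SimpleGraph V) (H : SimpleGraph W) : Prop :=
  ∃ t : ℕ, wlHistogram G k t ≠ wlHistogram H k t

/-- `k`-WL can count the substructure `S`: it distinguishes any two finite graphs that have different
numbers of (not necessarily induced) subgraphs isomorphic to `S`. -/
def WLCounts {U : Type*} (k : ℕ) (S : SimpleGraph U) : Prop :=
  ∀ (V W : Type) [Fintype V] [Fintype W] (G : SimpleGraph V) (H : SimpleGraph W),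
    G.copyCount S ≠ H.copyCount S → WLDistinguishes k G H

/-- The vertices `u_{a,v}` of the `ℓ`-th graph: `a` is one of `k + 1` indices (here `0, …, k`) and
`v` is a bit string of length `k` with an even number of ones if `a + ℓ ≤ k`, and an odd number of
ones for the last `ℓ` indices `a`. -/
abbrev CFIVertex (k l : ℕ) : Type :=
  {p : Fin (k + 1) × (Fin k → ZMod 2) // ∑ i, p.2 i = if (p.1 : ℕ) + l ≤ k then 0 else 1}

/-- The CFI-type graph: `u_{a,v}` and `u_{a',v'}` are adjacent iff, for some `j ∈ {1, …, k}`,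
`a' ≡ a + j` modulo `k + 1` and the `j`-th bit of `v` is the `(k + 1 - j)`-th bit of `v'`.
With `i : Fin k` for `j - 1`, the number `j` is `i.succ` (addition in `Fin (k + 1)` is modulo `k + 1`),
and bit `k + 1 - j` is bit `i.rev`. -/
def cfiGraph (k l : ℕ) : SimpleGraph (CFIVertex k l) where
  Adj p q := ∃ i : Fin k, q.1.1 = p.1.1 + i.succ ∧ p.1.2 i = q.1.2 i.rev
  symm := ⟨by
    rintro p q ⟨i, h, e⟩
    refine ⟨i.rev, ?_, by rw [Fin.rev_rev]; exact e.symm⟩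
    have hi : i.succ + i.rev.succ = 0 := by
      ext
      have := i.isLt
      simp only [Fin.val_add, Fin.val_succ, Fin.val_rev, Fin.val_zero]
      rw [show (i : ℕ) + 1 + (k - (i + 1) + 1) = k + 1 by omega, Nat.mod_self]
    rw [h, add_assoc, hi, add_zero]⟩
  loopless := ⟨by
    rintro p ⟨i, h, -⟩
    exact Fin.succ_ne_zero i (by simpa using h.symm)⟩

/-! The vertices form `k + 1` clouds, one per index `a`; the bits of a vertex sit on the edges of
the complete graph on the indices, and adjacency means agreement on the common edge. A clique
meeting every cloud labels each edge once, so its bits sum to zero over both ends; a single odd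
cloud forbids this. `k`-WL sees at most `k` clouds at a time. Adding a flip vector in each cloud
turns one parity pattern into another and preserves adjacency wherever both ends of an edge are
flipped alike; the unseen cloud absorbs the parity defect (`exists_flip_extend`,
`wlColor_flipVertex`). Small patterns are counted by padding their labelled copies to `k`-tuples:
round `0` already recognizes these. -/

namespace SimpleGraph

variable {U V : Type*}

/-- Labelled copies are pairs of a subgraph and a parametrization of it. -/
lemma labelledCopyCount_eq_copyCount_mul [Fintype U] [Fintype V] (G : SimpleGraph V)
    (S : SimpleGraph U) : G.labelledCopyCount S = G.copyCount S * Nat.card (S ≃g S) := by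
  classical
  let F : (Σ G' : {G' : G.Subgraph // Nonempty (S ≃g G'.coe)}, S ≃g G'.1.coe) → Copy S G :=
    fun p => p.1.1.coeCopy.comp p.2.toCopy
  have hF : Function.Bijective F := by
    refine ⟨?_, fun f => ⟨⟨⟨f.toSubgraph, ⟨f.isoToSubgraph⟩⟩, f.isoToSubgraph⟩, rfl⟩⟩
    have key : ∀ p, (F p).toSubgraph = p.1.1 := by
      rintro ⟨⟨G', h⟩, e⟩
      change Subgraph.map (G'.hom.comp e.toHom) ⊤ = G'
      simp [Subgraph.map_comp]
    rintro ⟨⟨G₁, h₁⟩, e₁⟩ ⟨⟨G₂, h₂⟩, e₂⟩ h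
    have hG : G₁ = G₂ := by
      have := congrArg Copy.toSubgraph h
      rwa [key, key] at this
    subst hG
    congr 1
    ext x
    exact DFunLike.congr_fun h x
  have hcard : G.labelledCopyCount S = Nat.card (Copy S G) := by
    rw [labelledCopyCount, Nat.card_eq_fintype_card]
  have haut : ∀ G' : {G' : G.Subgraph // Nonempty (S ≃g G'.coe)},
      Nat.card (S ≃g G'.1.coe) = Nat.card (S ≃g S) := fun ⟨_, ⟨e⟩⟩ =>
    Nat.card_congr ⟨fun g => g.trans e.symm, fun g => g.trans e,
      fun g => by ext; simp, fun g => by ext; simp⟩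
  have hfin : ∀ G' : {G' : G.Subgraph // Nonempty (S ≃g G'.coe)}, Finite (S ≃g G'.1.coe) :=
    fun G' => Finite.of_injective (fun g => (g : U → G'.1.verts)) DFunLike.coe_injective
  rw [hcard, ← Nat.card_eq_of_bijective F hF, Nat.card_sigma]
  simp only [haut, sum_const, smul_eq_mul, copyCount, card_univ, Fintype.card_subtype]

end SimpleGraph

/-- A colour of round `0` describes an injective homomorphism from `S`, composed with `ρ`. -/
def IsCopyColor {U : Type*} (S : SimpleGraph U) (k : ℕ) (ι : U → Fin k) (ρ : Fin k → U)
    (c : WLColor k 0) : Prop :=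
  (∀ i j, (c (ι i) (ι j)).1 → i = j) ∧ (∀ i j, S.Adj i j → (c (ι i) (ι j)).2) ∧
    ∀ j, (c (ι (ρ j)) j).1

/-- Labelled copies correspond to the tuples whose colour of round `0` is a copy colour. -/
def copyEquivTuples {U V : Type*} [Fintype V] (G : SimpleGraph V) (S : SimpleGraph U) (k : ℕ)
    (ι : U → Fin k) (ρ : Fin k → U) (h : Function.LeftInverse ρ ι) :
    SimpleGraph.Copy S G ≃ {v : Fin k → V // IsCopyColor S k ι ρ (wlColor G k 0 v)} where
  toFun f := ⟨fun j => f (ρ j), by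
    refine ⟨fun i j e => ?_, fun i j e => ?_, fun j => ?_⟩
    · simpa [wlColor, h i, h j] using f.injective e
    · simpa [wlColor, h i, h j] using f.toHom.map_adj e
    · simp [wlColor, h (ρ j)]⟩
  invFun v := ⟨⟨fun i => v.1 (ι i), fun {i j} e => v.2.2.1 i j e⟩, fun i j e => v.2.1 i j e⟩
  left_inv f := by
    ext i
    exact congrArg f (h i)
  right_inv v := Subtype.ext (funext fun j => v.2.2.2 j)

lemma countP_wlHistogram {V : Type*} [Fintype V] (G : SimpleGraph V) (k t : ℕ)
    (P : WLColor k t → Prop) [DecidablePred P] :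
    (wlHistogram G k t).countP P = Nat.card {v : Fin k → V // P (wlColor G k t v)} := by
  rw [wlHistogram, Multiset.countP_map, Nat.card_eq_fintype_card, Fintype.card_subtype]
  rfl

/-- `k`-WL counts every nonempty graph on at most `k` vertices, in fact at round `0`. -/
lemma wlCounts_of_card_le {U : Type*} [Fintype U] [Nonempty U] (S : SimpleGraph U) (k : ℕ)
    (hk : Fintype.card U ≤ k) : WLCounts k S := by
  classical
  intro V W _ _ G H hne
  refine ⟨0, fun heq => hne ?_⟩
  obtain ⟨ι⟩ : Nonempty (U ↪ Fin k) := Function.Embedding.nonempty_of_card_le (by simpa using hk)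
  have hinv := Function.leftInverse_invFun ι.injective
  have hcount : ∀ {X : Type} [Fintype X] (K : SimpleGraph X), K.labelledCopyCount S =
      (wlHistogram K k 0).countP (IsCopyColor S k ι (Function.invFun ι)) := by
    intro X _ K
    rw [countP_wlHistogram, ← Nat.card_congr (copyEquivTuples K S k ι _ hinv),
      SimpleGraph.labelledCopyCount, Nat.card_eq_fintype_card]
  have hlab : G.labelledCopyCount S = H.labelledCopyCount S := by rw [hcount, hcount, heq]
  -- The automorphism group is finite and nonempty, so its order cancels.
  have : Finite (S ≃g S) := Finite.of_injective (fun g => (g : U → U)) DFunLike.coe_injective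
  have : Nonempty (S ≃g S) := ⟨SimpleGraph.Iso.refl⟩
  rw [SimpleGraph.labelledCopyCount_eq_copyCount_mul,
    SimpleGraph.labelledCopyCount_eq_copyCount_mul] at hlab
  exact Nat.eq_of_mul_eq_mul_right Nat.card_pos hlab

/-! ### Parity flips and indistinguishability -/

section CFI

variable {k l l' : ℕ}

lemma exists_eq_add_succ {a b : Fin (k + 1)} (h : a ≠ b) : ∃ i : Fin k, b = a + i.succ := by
  obtain ⟨i, hi⟩ := Fin.exists_succ_eq.2 (sub_ne_zero.2 h.symm)
  exact ⟨i, by rw [hi, add_sub_cancel]⟩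

lemma add_succ_add_rev_succ (a : Fin (k + 1)) (i : Fin k) : a + i.succ + i.rev.succ = a := by
  have hi : i.succ + i.rev.succ = 0 := by
    ext
    have := i.isLt
    simp only [Fin.val_add, Fin.val_succ, Fin.val_rev, Fin.val_zero]
    rw [show (i : ℕ) + 1 + (k - (i + 1) + 1) = k + 1 by omega, Nat.mod_self]
  rw [add_assoc, hi, add_zero]

lemma add_succ_ne_self (a : Fin (k + 1)) (i : Fin k) : a + i.succ ≠ a := fun h =>
  Fin.succ_ne_zero i (add_eq_left.1 h)

/-- A flip vector per index whose parities turn the parities of `cfiGraph k l` into those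
of `cfiGraph k l'`. -/
def IsFlip (k l l' : ℕ) (f : Fin (k + 1) → Fin k → ZMod 2) : Prop :=
  ∀ a : Fin (k + 1), ∑ i, f a i =
    (if (a : ℕ) + l ≤ k then 0 else 1) + (if (a : ℕ) + l' ≤ k then 0 else 1)

lemma IsFlip.symm {f : Fin (k + 1) → Fin k → ZMod 2} (hf : IsFlip k l l' f) : IsFlip k l' l f :=
  fun a => (hf a).trans (add_comm _ _)

/-- The flip map on vertices. -/
def flipVertex {f : Fin (k + 1) → Fin k → ZMod 2} (hf : IsFlip k l l' f) (p : CFIVertex k l) :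
    CFIVertex k l' :=
  ⟨(p.1.1, p.1.2 + f p.1.1), by
    simp only [Pi.add_apply, sum_add_distrib, p.2, hf p.1.1]
    rw [← add_assoc, CharTwo.add_self_eq_zero, zero_add]⟩

lemma flipVertex_flipVertex {f : Fin (k + 1) → Fin k → ZMod 2} (hf : IsFlip k l l' f)
    (hf' : IsFlip k l' l f) (p : CFIVertex k l) : flipVertex hf' (flipVertex hf p) = p := by
  refine Subtype.ext (Prod.ext rfl (funext fun i => ?_))
  simp [flipVertex, add_assoc, CharTwo.add_self_eq_zero]

/-- The flip map on vertices, as an equivalence. -/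
def flipEquiv {f : Fin (k + 1) → Fin k → ZMod 2} (hf : IsFlip k l l' f) :
    CFIVertex k l ≃ CFIVertex k l' where
  toFun := flipVertex hf
  invFun := flipVertex hf.symm
  left_inv := flipVertex_flipVertex hf hf.symm
  right_inv := flipVertex_flipVertex hf.symm hf

/-- The two ends of every edge between indices in `A` are flipped simultaneously. -/
def FlipConsistentOn (f : Fin (k + 1) → Fin k → ZMod 2) (A : Finset (Fin (k + 1))) : Prop :=
  ∀ a ∈ A, ∀ i : Fin k, a + i.succ ∈ A → f a i = f (a + i.succ) i.rev

lemma FlipConsistentOn.mono {f : Fin (k + 1) → Fin k → ZMod 2} {A B : Finset (Fin (k + 1))}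
    (hf : FlipConsistentOn f B) (h : A ⊆ B) : FlipConsistentOn f A :=
  fun a ha i hi => hf a (h ha) i (h hi)

lemma cfiGraph_adj_flipVertex {f : Fin (k + 1) → Fin k → ZMod 2} (hf : IsFlip k l l' f)
    {A : Finset (Fin (k + 1))} (hA : FlipConsistentOn f A) {p q : CFIVertex k l}
    (hp : p.1.1 ∈ A) (hq : q.1.1 ∈ A) :
    (cfiGraph k l').Adj (flipVertex hf p) (flipVertex hf q) ↔ (cfiGraph k l).Adj p q := by
  refine exists_congr fun i => and_congr_right fun (h : q.1.1 = p.1.1 + i.succ) => ?_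
  have := hA _ hp i (h ▸ hq)
  simp only [flipVertex, Pi.add_apply]
  rw [this, ← h, add_left_inj]

/-- A consistent flip on `A` extends to one more index `a`, as long as some index remains
that can absorb the parity. -/
lemma exists_flip_extend {f : Fin (k + 1) → Fin k → ZMod 2} (hf : IsFlip k l l' f)
    {A : Finset (Fin (k + 1))} (hA : FlipConsistentOn f A) (a : Fin (k + 1))
    (hcard : #(insert a A) ≤ k) :
    ∃ f', IsFlip k l l' f' ∧ FlipConsistentOn f' (insert a A) ∧ ∀ c ∈ A, f' c = f c := by
  by_cases ha : a ∈ A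
  · exact ⟨f, hf, by rwa [insert_eq_of_mem ha], fun _ _ => rfl⟩
  -- At most `k` of the `k + 1` indices are in use. The bit of `a` on the edge to the spare index
  -- `b` is unconstrained and can correct the parity.
  obtain ⟨b, hb⟩ : ∃ b, b ∉ insert a A := by
    by_contra! h
    have := card_eq_of_equiv_fin (Equiv.subtypeUnivEquiv h)
    omega
  rw [mem_insert, not_or] at hb
  obtain ⟨i₀, hi₀⟩ := exists_eq_add_succ (Ne.symm hb.1)
  let g : Fin k → ZMod 2 := fun i => if a + i.succ ∈ A then f (a + i.succ) i.rev else 0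
  let h : Fin k → ZMod 2 := g + Pi.single i₀ (∑ i, f a i - ∑ i, g i)
  have hh : ∀ i, a + i.succ ∈ A → h i = f (a + i.succ) i.rev := by
    intro i hi
    have : i ≠ i₀ := by
      rintro rfl
      exact hb.2 (hi₀ ▸ hi)
    simp [h, g, hi, this]
  have hne : ∀ c ∈ A, c ≠ a := fun c hc e => ha (e ▸ hc)
  refine ⟨Function.update f a h, fun c => ?_, fun c hc i hi => ?_, fun c hc => ?_⟩
  · rcases eq_or_ne c a with rfl | hca
    · rw [← hf c, Function.update_self]
      simp [h, sum_add_distrib]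
    · rw [Function.update_of_ne hca, hf c]
  · rw [mem_insert] at hc hi
    rcases hc with rfl | hc
    · have hi := hi.resolve_left (add_succ_ne_self c i)
      rw [Function.update_self, Function.update_of_ne (hne _ hi), hh i hi]
    · rw [Function.update_of_ne (hne c hc)]
      rcases hi with hi | hi
      · have hc' : a + i.rev.succ = c := by rw [← hi, add_succ_add_rev_succ]
        rw [hi, Function.update_self, hh i.rev (hc' ▸ hc), hc', Fin.rev_rev]
      · rw [Function.update_of_ne (hne _ hi), hA c hc i hi]
  · rw [Function.update_of_ne (hne c hc)]

/-- The indices are added one at a time; `0 < k` supplies a bit to carry the parity in the empty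
case. -/
lemma exists_flip (hk : 0 < k) (l l' : ℕ) (A : Finset (Fin (k + 1))) (hcard : #A ≤ k) :
    ∃ f, IsFlip k l l' f ∧ FlipConsistentOn f A := by
  induction A using Finset.induction with
  | empty =>
    refine ⟨fun a => Pi.single ⟨0, hk⟩
      ((if (a : ℕ) + l ≤ k then 0 else 1) + (if (a : ℕ) + l' ≤ k then 0 else 1)),
      fun a => ?_, fun a ha => absurd ha (notMem_empty a)⟩
    rw [sum_pi_single', if_pos (mem_univ _)]
  | insert a A ha ih =>
    obtain ⟨f, hf, hfA⟩ := ih ((card_le_card (subset_insert a A)).trans hcard)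
    obtain ⟨f', hf', hfA', -⟩ := exists_flip_extend hf hfA a hcard
    exact ⟨f', hf', hfA'⟩

lemma map_univ_val_eq_of_equiv {α β γ : Type*} [Fintype α] [Fintype β] (e : α ≃ β)
    {p : α → γ} {q : β → γ} (h : ∀ x, p x = q (e x)) :
    (univ : Finset α).val.map p = (univ : Finset β).val.map q := by
  rw [← Finset.map_univ_equiv e, Finset.map_val, Multiset.map_map]
  exact Multiset.map_congr rfl fun x _ => h x

/-- The indices of the vertices of a tuple. -/
def tupleIndices (v : Fin k → CFIVertex k l) : Finset (Fin (k + 1)) :=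
  univ.image fun i => (v i).1.1

/-- A flip that is consistent on the indices of a tuple preserves its colours. -/
lemma wlColor_flipVertex (t : ℕ) (v : Fin k → CFIVertex k l)
    {f : Fin (k + 1) → Fin k → ZMod 2} (hf : IsFlip k l l' f)
    (hv : FlipConsistentOn f (tupleIndices v)) :
    wlColor (cfiGraph k l) k t v = wlColor (cfiGraph k l') k t (fun i => flipVertex hf (v i)) := by
  have hmem : ∀ i, (v i).1.1 ∈ tupleIndices v := fun i => mem_image_of_mem _ (mem_univ i)
  induction t generalizing v f with
  | zero =>
    refine funext fun i => funext fun j => Prod.ext (propext ?_) (propext ?_)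
    · exact (flipEquiv hf).injective.eq_iff.symm
    · exact (cfiGraph_adj_flipVertex hf hv (hmem i) (hmem j)).symm
  | succ t ih =>
    refine Prod.ext (ih v hf hv hmem) (funext fun i => ?_)
    -- Dropping coordinate `i` leaves at most `k - 1` indices, so there is room for the index of any
    -- new vertex.
    set A : Finset (Fin (k + 1)) := (univ.erase i).image fun j => (v j).1.1 with hAdef
    have hA : FlipConsistentOn f A := hv.mono (image_subset_image (erase_subset _ _))
    have hcard : ∀ a, #(insert a A) ≤ k := fun a => by
      have h₁ : #A ≤ #(univ.erase i) := card_image_le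
      rw [card_erase_of_mem (mem_univ i), card_univ, Fintype.card_fin] at h₁
      have h₂ := card_insert_le a A
      have := i.isLt
      omega
    choose F hF hFA hFf using fun a => exists_flip_extend hf hA a (hcard a)
    -- Each `w` is moved by the extension chosen for its own index. Flips preserve indices, so this
    -- diagonal choice is again a flip, hence a bijection.
    have hD : IsFlip k l l' fun a => F a a := fun a => hF a a
    refine map_univ_val_eq_of_equiv (flipEquiv hD) fun w => ?_
    have hsub : tupleIndices (Function.update v i w) ⊆ insert w.1.1 A := by
      intro c hc
      obtain ⟨j, -, rfl⟩ := mem_image.1 hc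
      rcases eq_or_ne j i with rfl | hj
      · simp
      · rw [Function.update_of_ne hj]
        exact mem_insert_of_mem (mem_image_of_mem _ (mem_erase.2 ⟨hj, mem_univ j⟩))
    rw [ih (Function.update v i w) (hF w.1.1) ((hFA _).mono hsub)
      fun i => mem_image_of_mem _ (mem_univ i)]
    congr 1
    funext j
    rcases eq_or_ne j i with rfl | hj
    · simp only [Function.update_self]
      rfl
    · simp only [Function.update_of_ne hj]
      refine Subtype.ext (Prod.ext rfl ?_)
      simp only [flipVertex]
      rw [hFf _ _ (mem_image_of_mem _ (mem_erase.2 ⟨hj, mem_univ j⟩))]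

theorem not_wlDistinguishes_cfiGraph (hk : 0 < k) (l l' : ℕ) :
    ¬ WLDistinguishes k (cfiGraph k l) (cfiGraph k l') := by
  rintro ⟨t, ht⟩
  refine ht ?_
  choose F hF hFA using fun α : Fin k → Fin (k + 1) =>
    exists_flip hk l l' (univ.image α) (card_image_le.trans_eq (by simp))
  -- The flip depends only on the tuple of indices, which it preserves, so the same choice undoes
  -- it.
  let e : (Fin k → CFIVertex k l) ≃ (Fin k → CFIVertex k l') :=
    { toFun := fun v i => flipVertex (hF fun j => (v j).1.1) (v i)
      invFun := fun v i => flipVertex (hF fun j => (v j).1.1).symm (v i)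
      left_inv := fun v => funext fun i => flipVertex_flipVertex (hF _) (hF _).symm (v i)
      right_inv := fun v => funext fun i => flipVertex_flipVertex (hF _).symm (hF _) (v i) }
  exact map_univ_val_eq_of_equiv e fun v => wlColor_flipVertex t v (hF _) (hFA _)

/-! ### Cliques -/

lemma exists_isNClique_cfiGraph_zero (k : ℕ) :
    ∃ s : Finset (CFIVertex k 0), (cfiGraph k 0).IsNClique (k + 1) s := by
  let P : Fin (k + 1) → CFIVertex k 0 := fun a => ⟨(a, 0), by
    have := a.isLt
    simp [Nat.lt_succ_iff.1 this]⟩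
  have hP : Function.Injective P := fun a b h => congrArg (fun p => p.1.1) h
  refine ⟨univ.map ⟨P, hP⟩, ?_, by simp⟩
  intro p hp q hq hpq
  simp only [coe_map, Function.Embedding.coeFn_mk, coe_univ, Set.image_univ, Set.mem_range] at hp hq
  obtain ⟨a, rfl⟩ := hp
  obtain ⟨b, rfl⟩ := hq
  obtain ⟨i, hi⟩ := exists_eq_add_succ (fun e => hpq (congrArg P e))
  exact ⟨i, hi, rfl⟩

/-- Adjacent vertices have distinct indices, so a clique of this size has one vertex per index. Its
bits cancel in pairs along edges, whereas the parities of the clouds add up to one. -/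
lemma cliqueFree_cfiGraph_one (k : ℕ) : (cfiGraph k 1).CliqueFree (k + 1) := by
  by_contra hfree
  obtain ⟨e⟩ := SimpleGraph.not_cliqueFree_iff_top_isContained _ |>.1 hfree
  have hadj : ∀ x y, x ≠ y → (cfiGraph k 1).Adj (e x) (e y) := fun x y h => e.toHom.map_adj h
  have hinj : Function.Injective fun x => (e x).1.1 := by
    intro x y hxy
    by_contra hne
    obtain ⟨i, hi, -⟩ := hadj x y hne
    exact add_succ_ne_self _ i (hi.symm.trans hxy.symm)
  obtain ⟨r, hr⟩ := (Finite.injective_iff_surjective.1 hinj).hasRightInverse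
  have hr' : ∀ a, (e (r a)).1.1 = a := hr
  have hbit : ∀ a i, (e (r a)).1.2 i = (e (r (a + i.succ))).1.2 i.rev := by
    intro a i
    have hne : r a ≠ r (a + i.succ) := fun h =>
      add_succ_ne_self a i (hr.injective h.symm)
    obtain ⟨j, hj, hbit⟩ := hadj _ _ hne
    rw [hr', hr', add_right_inj, Fin.succ_inj] at hj
    rwa [← hj] at hbit
  have hzero : ∑ p : Fin (k + 1) × Fin k, (e (r p.1)).1.2 p.2 = 0 := by
    refine sum_involution (fun p _ => (p.1 + p.2.succ, p.2.rev)) ?_ ?_ ?_ ?_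
    · intro p _
      rw [← hbit, CharTwo.add_self_eq_zero]
    · intro p _ _ h
      exact add_succ_ne_self p.1 p.2 (congrArg Prod.fst h)
    · exact fun _ _ => mem_univ _
    · intro p _
      simp [add_succ_add_rev_succ]
  rw [Fintype.sum_prod_type] at hzero
  simp only [(e (r _)).2, hr'] at hzero
  -- Only the last index has odd parity.
  rw [Fin.sum_univ_castSucc] at hzero
  simp at hzero

end CFI

theorem theorem4p1 (m : ℕ) (hm : 2 ≤ m) :
    (∃ s : Finset (CFIVertex m 0), (cfiGraph m 0).IsNClique (m + 1) s) ∧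
    (¬ ∃ s : Finset (CFIVertex m 1), (cfiGraph m 1).IsNClique (m + 1) s) ∧
    ¬ WLDistinguishes m (cfiGraph m 0) (cfiGraph m 1) ∧
    (∀ n ≤ m, ∀ S : SimpleGraph (Fin n), S.Connected → WLCounts m S) ∧
    ¬ WLCounts m (⊤ : SimpleGraph (Fin (m + 1))) := by
  have hG := exists_isNClique_cfiGraph_zero m
  have hH := cliqueFree_cfiGraph_one m
  have hWL := not_wlDistinguishes_cfiGraph (by omega : 0 < m) 0 1
  refine ⟨hG, fun ⟨s, hs⟩ => hH s hs, hWL, fun n hn S hS => ?_, fun hcount => ?_⟩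
  · have := hS.nonempty
    exact wlCounts_of_card_le S m (by simpa using hn)
  · refine hWL (hcount _ _ _ _ fun heq => ?_)
    obtain ⟨s, hs⟩ := hG
    have hzero : (cfiGraph m 1).copyCount (⊤ : SimpleGraph (Fin (m + 1))) = 0 :=
      SimpleGraph.copyCount_eq_zero.2 fun ⟨c⟩ =>
        (SimpleGraph.not_cliqueFree_iff_top_isContained _).2 ⟨c⟩ hH
    rw [hzero, SimpleGraph.copyCount_eq_zero] at heq
    exact heq ((SimpleGraph.not_cliqueFree_iff_top_isContained _).1 fun h => h s hs)
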